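/- Let $s\ge 3$, $m=2s$, $q=2^m$, let $\mathrm{Tr}$ be the trace from $\mathbb F_q$ to $\mathbb F_2$, and let $$\mathcal C=\{(\mathrm{Tr}(ax^5+bx^3+cx)+h)_{x\in\mathbb F_q}: a,b,c\in\mathbb F_q,\ h\in\mathbb F_2\}\subseteq \mathbb F_2^{\mathbb F_q}.$$ (1) $\mathcal C$ is affine-invariant: it is invariant under all coordinate permutations $x\mapsto ux+v$ ($u\in\mathbb F_q^*$, $v\in\mathbb F_q$), and it is an extended cyclic code, i.e. for every generator $\alpha$ of $\mathbb F_q^*$, labelling coordinate $j$ by $\alpha^j$ for $0\le j\le q-2$ and the last coordinate by $0$, it consists of the words of a cyclic code of length $q-1$ extended by an overall parity bit. (2) For every $i\neq 0$ such that $\mathcal C$ has a codeword of Hamming weight $i$, the set of supports of the codewords of weight $i$ is the block set of a $2$-$(2^m,i,\lambda)$ design on the point set $\mathbb F_q$ for some integer $\lambda>0$, that is, every block has $i$ points and every two distinct points lie in exactly $\lambda$ blocks (the case $i=2^m$, with the single block $\mathbb F_q$, is allowed). (3) Each of the following seven values of $i$ is the weight of a codeword of $\mathcal C$, and the corresponding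 design has the parameter $\lambda$ given next to it: - $i=2^{2s-1}$, $\lambda=\dfrac{(29\cdot2^{6s-5}-33\cdot2^{4s-5}+17\cdot2^{2s-3}-2)(2^{2s-1}-1)}{2(2^{2s}-1)}$; - $i=2^{2s-1}-2^{s-1}$, $\lambda=\frac{2}{15}\cdot2^{s-1}(3\cdot2^{4s}+5\cdot2^{2s}-8)(2^{2s-1}-2^{s-1}-1)/(2^s+1)$; - $i=2^{2s-1}+2^{s-1}$, $\lambda=\frac{2}{15}\cdot2^{s-1}(3\cdot2^{4s}+5\cdot2^{2s}-8)(2^{2s-1}+2^{s-1}-1)/(2^s-1)$; - $i=2^{2s-1}-2^{s}$, $\lambda=\frac{7}{3}\cdot2^{3s-4}(2^{2s-1}-2^s-1)(2^{s-1}-1)$; - $i=2^{2s-1}+2^{s}$, $\lambda=\frac{7}{3}\cdot2^{3s-4}(2^{2s-1}+2^s-1)(2^{s-1}+1)$; - $i=2^{2s-1}-2^{s+1}$, $\lambda=\frac{1}{15}\cdot2^{s-3}(2^{4s-2}-5\cdot2^{2s-2}+1)(2^{2s-1}-2^{s+1}-1)(2^{s-2}-1)/(2^{2s}-1)$; - $i=2^{2s-1}+2^{s+1}$,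 $\lambda=\frac{1}{15}\cdot2^{s-3}(2^{4s-2}-5\cdot2^{2s-2}+1)(2^{2s-1}+2^{s+1}-1)(2^{s-2}+1)/(2^{2s}-1)$. -/

import Mathlib

/-! ### Designs -/

/-- `B` is (the block set of) a `t`-`(v, k, l)` design on the point set `P`. -/
structure IsTDesign {P : Type*} [Fintype P] (B : Set (Finset P)) (t v k l : ℕ) : Prop where
  card_points : Fintype.card P = v
  one_le_t : 1 ≤ t
  t_le_k : t ≤ k
  k_le_v : k ≤ v
  card_block : ∀ b ∈ B, b.card = k
  balanced : ∀ T : Finset P, T.card = t → {b ∈ B | T ⊆ b}.ncard = l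

/-! ### Binary codes with coordinates indexed by a finite type -/

/-- The support of a word. -/
def wordSupport {ι : Type*} [Fintype ι] (c : ι → ZMod 2) : Finset ι :=
  Finset.univ.filter fun x => c x ≠ 0

/-- The number `A_i` of codewords of Hamming weight `i`. -/
noncomputable def weightCount {ι : Type*} [Fintype ι] (C : Submodule (ZMod 2) (ι → ZMod 2))
    (i : ℕ) : ℕ :=
  {c : ι → ZMod 2 | c ∈ C ∧ hammingNorm c = i}.ncard

/-- The set of the supports of all codewords of Hamming weight `i`. -/
def supportBlocks {ι : Type*} [Fintype ι] (C : Submodule (ZMod 2) (ι → ZMod 2)) (i : ℕ) :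
    Set (Finset ι) :=
  {b | ∃ c ∈ C, hammingNorm c = i ∧ b = wordSupport c}

/-- The permutation automorphism group: coordinate permutations mapping the code to itself. -/
def PAut {ι : Type*} (C : Submodule (ZMod 2) (ι → ZMod 2)) : Subgroup (Equiv.Perm ι) where
  carrier := {σ | ∀ c : ι → ZMod 2, c ∘ σ ∈ C ↔ c ∈ C}
  mul_mem' := by
    intro σ τ hσ hτ c
    have h := hτ (c ∘ σ)
    rw [hσ c] at h
    exact h
  one_mem' := fun _ => Iff.rfl
  inv_mem' := by
    intro σ hσ c
    have h := hσ (c ∘ (σ⁻¹ : Equiv.Perm ι))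
    have e : (c ∘ (σ⁻¹ : Equiv.Perm ι)) ∘ σ = c := by
      funext x
      simp
    rw [e] at h
    exact h.symm

/-- The affine group of all permutations `x ↦ a x + b` of `F` with `a ≠ 0`. -/
def affineGroup (F : Type*) [Field F] : Set (Equiv.Perm F) :=
  {σ | ∃ a b : F, a ≠ 0 ∧ ∀ x, σ x = a * x + b}

/-- A linear code of length `n` is cyclic if it is closed under the cyclic shift. -/
def IsCyclicCode {n : ℕ} (C : Submodule (ZMod 2) (Fin n → ZMod 2)) : Prop :=
  ∀ c ∈ C, (fun i => c (finRotate n i)) ∈ C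

/-- The extended code: append an overall parity coordinate. -/
def extendedCode {n : ℕ} (C : Submodule (ZMod 2) (Fin n → ZMod 2)) :
    Submodule (ZMod 2) (Fin (n + 1) → ZMod 2) where
  carrier := {c | (fun i : Fin n => c i.castSucc) ∈ C ∧ ∑ i, c i = 0}
  add_mem' := by
    rintro c d ⟨hc, hc'⟩ ⟨hd, hd'⟩
    refine ⟨C.add_mem hc hd, ?_⟩
    simp only [Pi.add_apply, Finset.sum_add_distrib, hc', hd', add_zero]
  zero_mem' := ⟨C.zero_mem, by simp⟩
  smul_mem' := by
    rintro r c ⟨hc, hc'⟩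
    refine ⟨C.smul_mem r hc, ?_⟩
    simp only [Pi.smul_apply, ← Finset.smul_sum, hc', smul_zero]

/-- The labelling of the coordinates `0, …, n` of an extended code of length `n + 1` by field
elements: `i < n` is labelled by `α ^ i`, and the parity coordinate `n` by `0`. -/
def coordLabel {F : Type*} [Field F] (α : Fˣ) (n : ℕ) : Fin (n + 1) → F :=
  Fin.snoc (α := fun _ => F) (fun i : Fin n => (α : F) ^ (i : ℕ)) 0

/-- A code with coordinates indexed by `F` is an extended (primitive) cyclic code with respect to
the generator `α` of the multiplicative group of `F`. -/
def IsExtendedCyclic {F : Type*} [Field F] [Fintype F] (α : Fˣ)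
    (C : Submodule (ZMod 2) (F → ZMod 2)) : Prop :=
  ∃ C₀ : Submodule (ZMod 2) (Fin (Fintype.card F - 1) → ZMod 2), IsCyclicCode C₀ ∧
    ∀ c : F → ZMod 2, c ∈ C ↔ c ∘ coordLabel α (Fintype.card F - 1) ∈ extendedCode C₀

/-- Affine-invariant code: an extended cyclic code whose permutation automorphism group contains
the affine group. -/
def IsAffineInvariant {F : Type*} [Field F] [Fintype F] (α : Fˣ)
    (C : Submodule (ZMod 2) (F → ZMod 2)) : Prop :=
  IsExtendedCyclic α C ∧ affineGroup F ⊆ (PAut C : Set (Equiv.Perm F))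

/-! ### The code -/

/-- The code of all words `(Tr(a x⁵ + b x³ + c x) + h)_{x ∈ F}` with `a, b, c ∈ F`, `h ∈ 𝔽₂`. -/
noncomputable def bchTraceCode (F : Type*) [Field F] [Algebra (ZMod 2) F] :
    Submodule (ZMod 2) (F → ZMod 2) where
  carrier := {w | ∃ (a b c : F) (h : ZMod 2),
    w = fun x => Algebra.trace (ZMod 2) F (a * x ^ 5 + b * x ^ 3 + c * x) + h}
  add_mem' := by
    rintro _ _ ⟨a, b, c, h, rfl⟩ ⟨a', b', c', h', rfl⟩
    refine ⟨a + a', b + b', c + c', h + h', ?_⟩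
    funext x
    simp only [Pi.add_apply, add_mul, map_add]
    ring
  zero_mem' := ⟨0, 0, 0, 0, by funext x; simp⟩
  smul_mem' := by
    rintro r _ ⟨a, b, c, h, rfl⟩
    refine ⟨r • a, r • b, r • c, r • h, ?_⟩
    funext x
    simp only [Pi.smul_apply, smul_add, smul_mul_assoc, map_add, map_smul]

/-! The codeword with coefficients `(a, b, c)` and constant `h` has weight (q ∓ S)/2, where S is the
sum of (-1)^Tr(ax⁵+bx³+cx) and `h` fixes the sign, so the weight distribution is the value
distribution of S.

The exponents 5 = 4+1 and 3 = 2+1 make the trace a quadratic form, plus a linear one. Squaring S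
leaves q times a character sum over the radical of the polar form. The radical is the zero set of a
linearized polynomial of degree at most 16 (`radicalPoly`), and the summand is a character on it, so
S² is 0 or q times the size of the radical (`quinticSum_sq_eq_zero_or`). Since q = (2^s)² is a
square, that size is 1, 4 or 16 if S ≠ 0, so S is 0, ±2^s, ±2^(s+1) or ±2^(s+2)
(`quinticSum_sq_mem`).

Four frequencies remain, one for each value of S². The moments of order 0, 2, 4, 6 determine them:
expanding S^n and summing over all triples counts relations among at most six points, and a
Vandermonde argument (the BCH bound for the dual) leaves only the trivial ones
(`sum_quinticSum_pow`).

Finally, substituting ux+v produces only extra x⁴ and x² terms, which the Frobenius invariance of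
the trace makes linear. Hence the doubly transitive affine group preserves the code, and double
counting gives λ·q(q-1) = A_i·i(i-1) (`exists_isTDesign`). -/

open Finset

/-! ### The sign character of `ZMod 2` and the trace character of a binary field -/

/-- The nontrivial character `0 ↦ 1`, `1 ↦ -1` of `ZMod 2`. -/
def binarySign (h : ZMod 2) : ℤ := if h = 0 then 1 else -1

theorem binarySign_add (g h : ZMod 2) : binarySign (g + h) = binarySign g * binarySign h := by
  revert g h; decide

theorem binarySign_zero : binarySign 0 = 1 := rfl

theorem binarySign_eq_one_or (h : ZMod 2) : binarySign h = 1 ∨ binarySign h = -1 := by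
  revert h; decide

theorem binarySign_mul_self (h : ZMod 2) : binarySign h * binarySign h = 1 := by
  revert h; decide

theorem sum_binarySign_eq {ι : Type*} [Fintype ι] (w : ι → ZMod 2) :
    ∑ x, binarySign (w x) = Fintype.card ι - 2 * (hammingNorm w : ℤ) := by
  have h : ∀ x, binarySign (w x) = 1 - 2 * (if w x ≠ 0 then 1 else 0) := by
    intro x
    by_cases hx : w x = 0 <;> simp [binarySign, hx]
  simp only [h, sum_sub_distrib, ← mul_sum, hammingNorm, sum_boole]
  simp

section TraceCharacter

variable {F : Type*} [Field F] [Algebra (ZMod 2) F]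

/-- The character `x ↦ (-1) ^ Tr x`. -/
noncomputable def traceSign (x : F) : ℤ := binarySign (Algebra.trace (ZMod 2) F x)

theorem traceSign_add (x y : F) : traceSign (x + y) = traceSign x * traceSign y := by
  simp [traceSign, binarySign_add]

theorem traceSign_zero : traceSign (0 : F) = 1 := by
  simp [traceSign, binarySign_zero]

theorem traceSign_mul_self (x : F) : traceSign x * traceSign x = 1 :=
  binarySign_mul_self _

theorem traceSign_sum {ι : Type*} (t : Finset ι) (f : ι → F) :
    traceSign (∑ i ∈ t, f i) = ∏ i ∈ t, traceSign (f i) := by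
  classical
  induction t using Finset.induction_on with
  | empty => simp [traceSign_zero]
  | insert i t hi ih => rw [sum_insert hi, prod_insert hi, traceSign_add, ih]

variable [Fintype F]

theorem trace_sq (x : F) : Algebra.trace (ZMod 2) F (x ^ 2) = Algebra.trace (ZMod 2) F x := by
  have h := Algebra.trace_eq_of_algEquiv (FiniteField.frobeniusAlgEquivOfAlgebraic (ZMod 2) F) x
  simpa [FiniteField.coe_frobeniusAlgEquivOfAlgebraic, ZMod.card] using h

theorem trace_pow_four (x : F) :
    Algebra.trace (ZMod 2) F (x ^ 4) = Algebra.trace (ZMod 2) F x := by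
  rw [show x ^ 4 = (x ^ 2) ^ 2 by ring, trace_sq, trace_sq]

theorem traceSign_sq (x : F) : traceSign (x ^ 2) = traceSign x := by
  simp [traceSign, trace_sq]

theorem traceSign_pow_four (x : F) : traceSign (x ^ 4) = traceSign x := by
  simp [traceSign, trace_pow_four]

theorem exists_traceSign_mul_eq_neg_one {a : F} (ha : a ≠ 0) :
    ∃ x, traceSign (a * x) = -1 := by
  by_contra! h
  apply ha
  refine (traceForm_nondegenerate (ZMod 2) F).1 a fun x => ?_
  have := h x
  rw [Algebra.traceForm_apply]
  by_contra hx
  exact this (by simp [traceSign, binarySign, hx])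

theorem sum_traceSign_mul [DecidableEq F] (a : F) :
    ∑ x, traceSign (a * x) = if a = 0 then (Fintype.card F : ℤ) else 0 := by
  split_ifs with ha
  · simp [ha, traceSign_zero]
  · obtain ⟨y, hy⟩ := exists_traceSign_mul_eq_neg_one ha
    have h : ∑ x, traceSign (a * (x + y)) = ∑ x, traceSign (a * x) :=
      Equiv.sum_comp (Equiv.addRight y) fun x => traceSign (a * x)
    simp only [mul_add, traceSign_add, hy, ← sum_mul] at h
    linarith

end TraceCharacter

/-! ### The radical polynomial -/

section Radical

variable {F : Type*} [Field F]

/-- The linearized polynomial whose roots form the radical of `Tr (a x⁵ + b x³)`. -/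
def radicalPoly (a b y : F) : F := a ^ 4 * y ^ 16 + b ^ 4 * y ^ 8 + b ^ 2 * y ^ 2 + a * y

theorem radicalPoly_add [CharP F 2] (a b x y : F) :
    radicalPoly a b (x + y) = radicalPoly a b x + radicalPoly a b y := by
  have h2 : (x + y) ^ 2 = x ^ 2 + y ^ 2 := add_pow_char x y 2
  have h8 : (x + y) ^ 8 = x ^ 8 + y ^ 8 := add_pow_char_pow x y 2 3
  have h16 : (x + y) ^ 16 = x ^ 16 + y ^ 16 := add_pow_char_pow x y 2 4
  simp only [radicalPoly, h2, h8, h16]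
  ring

/-- The radical of `Tr (a x⁵ + b x³)` as an additive subgroup. -/
def radicalSubgroup [CharP F 2] (a b : F) : AddSubgroup F where
  carrier := {y | radicalPoly a b y = 0}
  add_mem' {x y} hx hy := by
    simp only [Set.mem_ofPred_eq] at hx hy ⊢
    rw [radicalPoly_add, hx, hy, add_zero]
  zero_mem' := by simp [radicalPoly]
  neg_mem' {x} hx := by
    have : -x = x := CharTwo.neg_eq x
    rwa [this]

variable [Fintype F]

theorem pow_two_pow_bijective [CharP F 2] (k : ℕ) :
    Function.Bijective fun x : F => x ^ 2 ^ k :=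
  Finite.injective_iff_bijective.mp (iterateFrobenius_inj F 2 k)

theorem card_radical_dvd [CharP F 2] [DecidableEq F] (a b : F) :
    #{y : F | radicalPoly a b y = 0} ∣ Fintype.card F := by
  have h := (radicalSubgroup a b).card_addSubgroup_dvd_card
  rw [Nat.card_eq_fintype_card (α := F)] at h
  convert h
  rw [← Fintype.card_subtype, ← Nat.card_eq_fintype_card]
  rfl

theorem card_radical_le [DecidableEq F] {a b : F} (hab : a ≠ 0 ∨ b ≠ 0) :
    #{y : F | radicalPoly a b y = 0} ≤ 16 := by
  open Polynomial in
  let p : F[X] := C (a ^ 4) * X ^ 16 + C (b ^ 4) * X ^ 8 + C (b ^ 2) * X ^ 2 + C a * X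
  have hp : p ≠ 0 := by
    intro h
    have h1 : p.coeff 16 = a ^ 4 := by
      simp only [p, Polynomial.coeff_add, Polynomial.coeff_C_mul, Polynomial.coeff_X_pow,
        Polynomial.coeff_X]
      norm_num
    have h2 : p.coeff 8 = b ^ 4 := by
      simp only [p, Polynomial.coeff_add, Polynomial.coeff_C_mul, Polynomial.coeff_X_pow,
        Polynomial.coeff_X]
      norm_num
    rw [h, Polynomial.coeff_zero] at h1 h2
    rcases hab with ha | hb
    · exact pow_ne_zero 4 ha h1.symm
    · exact pow_ne_zero 4 hb h2.symm
  have hdeg : p.natDegree ≤ 16 := by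
    simp only [p]
    compute_degree
  refine le_trans (card_le_card (t := p.roots.toFinset) fun y hy => ?_)
    ((Multiset.toFinset_card_le _).trans ((Polynomial.card_roots' p).trans hdeg))
  rw [mem_filter] at hy
  rw [Multiset.mem_toFinset, Polynomial.mem_roots hp, Polynomial.IsRoot.def, ← hy.2]
  simp [p, radicalPoly]

end Radical

/-! ### The exponential sums -/

section ExponentialSum

variable {F : Type*} [Field F] [Fintype F] [Algebra (ZMod 2) F]

/-- The sum of `(-1) ^ Tr (a x⁵ + b x³ + c x)` over all field elements `x`. -/
noncomputable def quinticSum (a b c : F) : ℤ :=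
  ∑ x, traceSign (a * x ^ 5 + b * x ^ 3 + c * x)

/-- The mixed terms are multiples of x⁴, x² and x. Frobenius powers, which preserve the trace, turn
each into a multiple of x⁴, and the coefficients add up to `radicalPoly`. -/
theorem traceSign_polarization [CharP F 2] (a b c x y : F) :
    traceSign (a * (x + y) ^ 5 + b * (x + y) ^ 3 + c * (x + y)) =
      traceSign (a * x ^ 5 + b * x ^ 3 + c * x) * traceSign (a * y ^ 5 + b * y ^ 3 + c * y) *
        traceSign (radicalPoly a b y * x ^ 4) := by
  have h2 : (x + y) ^ 2 = x ^ 2 + y ^ 2 := add_pow_char x y 2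
  have h4 : (x + y) ^ 4 = x ^ 4 + y ^ 4 := by
    rw [show (x + y) ^ 4 = ((x + y) ^ 2) ^ 2 by ring, h2, add_pow_char]; ring
  have e : a * (x + y) ^ 5 + b * (x + y) ^ 3 + c * (x + y) =
      (a * x ^ 5 + b * x ^ 3 + c * x) + (a * y ^ 5 + b * y ^ 3 + c * y) +
        (a * y * x ^ 4 + a * y ^ 4 * x + b * y * x ^ 2 + b * y ^ 2 * x) := by
    rw [show (x + y) ^ 5 = (x + y) ^ 4 * (x + y) by ring,
      show (x + y) ^ 3 = (x + y) ^ 2 * (x + y) by ring, h2, h4]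
    ring
  rw [e, traceSign_add, traceSign_add]
  congr 1
  simp only [radicalPoly, add_mul, traceSign_add]
  rw [← traceSign_pow_four (a * y ^ 4 * x), ← traceSign_sq (b * y * x ^ 2),
    ← traceSign_pow_four (b * y ^ 2 * x)]
  rw [show (a * y ^ 4 * x) ^ 4 = a ^ 4 * y ^ 16 * x ^ 4 by ring,
    show (b * y * x ^ 2) ^ 2 = b ^ 2 * y ^ 2 * x ^ 4 by ring,
    show (b * y ^ 2 * x) ^ 4 = b ^ 4 * y ^ 8 * x ^ 4 by ring]
  ring

/-- In the double sum over x and x + y, polarization leaves a linear character of x⁴. As x ↦ x⁴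
permutes the field, orthogonality kills every y outside the radical. -/
theorem quinticSum_sq [CharP F 2] [DecidableEq F] (a b c : F) :
    quinticSum a b c ^ 2 = Fintype.card F *
      ∑ y with radicalPoly a b y = 0, traceSign (a * y ^ 5 + b * y ^ 3 + c * y) := by
  have h : quinticSum a b c ^ 2 = ∑ y, ∑ x, traceSign (a * x ^ 5 + b * x ^ 3 + c * x) *
      traceSign (a * (x + y) ^ 5 + b * (x + y) ^ 3 + c * (x + y)) := by
    rw [sum_comm, sq, quinticSum, sum_mul]
    refine sum_congr rfl fun x _ => ?_
    rw [← mul_sum]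
    congr 1
    exact (Equiv.sum_comp (Equiv.addLeft x)
      fun z => traceSign (a * z ^ 5 + b * z ^ 3 + c * z)).symm
  have h4 : ∀ d : F, ∑ x, traceSign (d * x ^ 4) = if d = 0 then (Fintype.card F : ℤ) else 0 := by
    intro d
    rw [← sum_traceSign_mul d]
    exact Equiv.sum_comp (Equiv.ofBijective _ (pow_two_pow_bijective (F := F) 2))
      fun x => traceSign (d * x)
  rw [h, sum_filter, mul_sum]
  refine sum_congr rfl fun y _ => ?_
  have : ∀ x, traceSign (a * x ^ 5 + b * x ^ 3 + c * x) *
      traceSign (a * (x + y) ^ 5 + b * (x + y) ^ 3 + c * (x + y)) =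
      traceSign (a * y ^ 5 + b * y ^ 3 + c * y) * traceSign (radicalPoly a b y * x ^ 4) := by
    intro x
    rw [traceSign_polarization, ← mul_assoc, ← mul_assoc, traceSign_mul_self, one_mul]
  simp only [this, ← mul_sum, h4]
  split_ifs <;> ring

/-- On the radical the polar term vanishes, so the summand is a character there: its sum is zero if
it takes the value -1, and the size of the radical otherwise. -/
theorem quinticSum_sq_eq_zero_or [CharP F 2] [DecidableEq F] (a b c : F) :
    quinticSum a b c ^ 2 = 0 ∨
      quinticSum a b c ^ 2 = Fintype.card F * #{y : F | radicalPoly a b y = 0} := by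
  rw [quinticSum_sq]
  by_cases h : ∃ y, radicalPoly a b y = 0 ∧ traceSign (a * y ^ 5 + b * y ^ 3 + c * y) = -1
  · left
    obtain ⟨y, hy, hs⟩ := h
    rw [mul_eq_zero]
    right
    have hsum : ∑ x with radicalPoly a b x = 0, traceSign (a * x ^ 5 + b * x ^ 3 + c * x) =
        ∑ x with radicalPoly a b x = 0,
          traceSign (a * (x + y) ^ 5 + b * (x + y) ^ 3 + c * (x + y)) := by
      simp only [sum_filter]
      rw [← Equiv.sum_comp (Equiv.addRight y)]
      refine sum_congr rfl fun x _ => ?_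
      simp [radicalPoly_add, hy]
    simp only [traceSign_polarization, hs, hy, zero_mul, traceSign_zero] at hsum
    rw [← sum_mul, ← sum_mul] at hsum
    linarith
  · right
    push Not at h
    rw [card_eq_sum_ones, Nat.cast_sum]
    congr 1
    refine sum_congr rfl fun y hy => ?_
    rw [mem_filter] at hy
    exact (binarySign_eq_one_or _).resolve_right (h y hy.2)

theorem quinticSum_zero_zero [DecidableEq F] (c : F) :
    quinticSum 0 0 c = if c = 0 then (Fintype.card F : ℤ) else 0 := by
  rw [← sum_traceSign_mul c]
  simp [quinticSum]

/-- The squares of the nontrivial sums over a field with `2 ^ (2 s)` elements. -/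
theorem quinticSum_sq_mem [CharP F 2] {s : ℕ} (hF : Fintype.card F = 2 ^ (2 * s)) {a b c : F}
    (h : (a, b, c) ≠ 0) :
    quinticSum a b c ^ 2 = 0 ∨ quinticSum a b c ^ 2 = (2 ^ s) ^ 2 ∨
      quinticSum a b c ^ 2 = (2 * 2 ^ s) ^ 2 ∨ quinticSum a b c ^ 2 = (4 * 2 ^ s) ^ 2 := by
  classical
  by_cases hab : a ≠ 0 ∨ b ≠ 0
  · rcases quinticSum_sq_eq_zero_or a b c with h0 | h1
    · exact .inl h0
    right
    have hle := card_radical_le hab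
    have hdvd := card_radical_dvd a b
    generalize #{y : F | radicalPoly a b y = 0} = r at *
    have hq : (Fintype.card F : ℤ) = (2 ^ s) ^ 2 := by rw [hF]; push_cast; ring
    rw [hq] at h1
    have hS : (2 ^ s : ℤ) ∣ quinticSum a b c := by
      rw [← Int.pow_dvd_pow_iff two_ne_zero, h1]
      exact dvd_mul_right _ _
    obtain ⟨t, ht⟩ := hS
    rw [ht, mul_pow] at h1
    -- The size of the radical is thus a perfect square; being also a power of two at most 16, it is
    -- 1, 4 or 16.
    have htr : t ^ 2 = r := mul_left_cancel₀ (by positivity) h1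
    rw [hF] at hdvd
    obtain ⟨k, -, rfl⟩ := (Nat.dvd_prime_pow Nat.prime_two).1 hdvd
    have hk : k ≤ 4 := (Nat.pow_le_pow_iff_right (by norm_num : 1 < 2)).1 (by simpa using hle)
    have ht4 : |t| ≤ 4 := by
      apply abs_le_of_sq_le_sq _ (by norm_num)
      rw [htr]; exact_mod_cast hle
    rw [ht, mul_pow]
    rw [abs_le] at ht4
    obtain ⟨h1, h2⟩ := ht4
    interval_cases k <;> interval_cases t <;> simp_all <;> ring_nf <;> simp
  · push Not at hab
    obtain ⟨rfl, rfl⟩ := hab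
    left
    have hc : c ≠ 0 := by rintro rfl; exact h rfl
    simp [quinticSum_zero_zero, hc]

end ExponentialSum

/-! ### Power moments -/

section Moments

/-- The number of words of length `n` over an alphabet of size `q` in which exactly the letters of
a given set of size `j` occur an odd number of times. -/
def parityWordCount (q : ℤ) : ℕ → ℕ → ℤ
  | 0, j => if j = 0 then 1 else 0
  -- Classify by the last letter, inside or outside the given set. At j = 0 the truncated j - 1 is
  -- harmless because its coefficient is zero.
  | n + 1, j => j * parityWordCount q n (j - 1) + (q - j) * parityWordCount q n (j + 1)

theorem parityWordCount_eq_zero_of_lt (q : ℤ) :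
    ∀ {n j : ℕ}, n < j → parityWordCount q n j = 0
  | 0, j, h => by simp [parityWordCount, h.ne']
  | n + 1, j, h => by
    rw [parityWordCount, parityWordCount_eq_zero_of_lt q (by omega : n < j - 1),
      parityWordCount_eq_zero_of_lt q (by omega : n < j + 1)]
    ring

theorem parityWordCount_eq_zero_of_odd (q : ℤ) :
    ∀ {n j : ℕ}, Odd (n + j) → parityWordCount q n j = 0
  | 0, j, h => by
    have : j ≠ 0 := by rintro rfl; simp at h
    simp [parityWordCount, this]
  | n + 1, j, h => by
    rw [parityWordCount, parityWordCount_eq_zero_of_odd q (n := n) (j := j + 1) (by grind)]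
    rcases Nat.eq_zero_or_pos j with rfl | hj
    · simp
    · rw [parityWordCount_eq_zero_of_odd q (n := n) (j := j - 1) (by grind)]
      ring

theorem parityWordCount_two_zero (q : ℤ) : parityWordCount q 2 0 = q := by
  simp [parityWordCount]

theorem parityWordCount_four_zero (q : ℤ) : parityWordCount q 4 0 = 3 * q ^ 2 - 2 * q := by
  simp [parityWordCount]; ring

theorem parityWordCount_six_zero (q : ℤ) :
    parityWordCount q 6 0 = 15 * q ^ 3 - 30 * q ^ 2 + 16 * q := by
  simp [parityWordCount]; ring

/-- The defining recursion in terms of sets: dropping the last letter y of a word toggles y in the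
set of letters of odd multiplicity. -/
theorem sum_parityWordCount_symmDiff {ι : Type*} [Fintype ι] [DecidableEq ι] (n : ℕ)
    (T : Finset ι) :
    ∑ y, parityWordCount (Fintype.card ι) n #(symmDiff T {y}) =
      parityWordCount (Fintype.card ι) (n + 1) #T := by
  have hmem : ∀ y ∈ T, symmDiff T {y} = T.erase y := by
    intro y hy; ext z; simp only [mem_symmDiff, mem_singleton, mem_erase]; grind
  have hnot : ∀ y ∈ Tᶜ, symmDiff T {y} = insert y T := by
    intro y hy; rw [mem_compl] at hy
    ext z; simp only [mem_symmDiff, mem_singleton, mem_insert]; grind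
  rw [← sum_add_sum_compl T, parityWordCount]
  congr 1
  · rw [sum_congr rfl fun y hy => by rw [hmem y hy, card_erase_of_mem hy]]
    simp
  · rw [sum_congr rfl fun y hy => by rw [hnot y hy, card_insert_of_notMem (mem_compl.1 hy)]]
    rw [sum_const, card_compl, nsmul_eq_mul, Nat.cast_sub (card_le_univ T)]

theorem prod_symmDiff_singleton {ι : Type*} [DecidableEq ι] {f : ι → ℤ}
    (hf : ∀ x, f x * f x = 1) (T : Finset ι) (y : ι) :
    ∏ x ∈ symmDiff T {y}, f x = f y * ∏ x ∈ T, f x := by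
  by_cases hy : y ∈ T
  · rw [show symmDiff T {y} = T.erase y by
      ext z; simp only [mem_symmDiff, mem_singleton, mem_erase]; grind,
      ← mul_prod_erase T f hy, ← mul_assoc, hf, one_mul]
  · rw [show symmDiff T {y} = insert y T by
      ext z; simp only [mem_symmDiff, mem_singleton, mem_insert]; grind,
      prod_insert hy]

/-- Expansion of a power of a sum of signs. -/
theorem sum_sign_pow {ι : Type*} [Fintype ι] [DecidableEq ι] {f : ι → ℤ}
    (hf : ∀ x, f x * f x = 1) (n : ℕ) :
    (∑ x, f x) ^ n = ∑ T : Finset ι, parityWordCount (Fintype.card ι) n #T * ∏ x ∈ T, f x := by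
  induction n with
  | zero => simp [parityWordCount]
  | succ n ih =>
    have h : ∀ y, ∑ T : Finset ι, parityWordCount (Fintype.card ι) n #T * ∏ x ∈ symmDiff T {y}, f x =
        ∑ T : Finset ι, parityWordCount (Fintype.card ι) n #(symmDiff T {y}) * ∏ x ∈ T, f x := by
      intro y
      refine sum_bij' (fun T _ => symmDiff T {y}) (fun T _ => symmDiff T {y}) ?_ ?_ ?_ ?_ ?_ <;>
        simp
    calc (∑ x, f x) ^ (n + 1)
        = ∑ y, ∑ T : Finset ι, parityWordCount (Fintype.card ι) n #T *
            ∏ x ∈ symmDiff T {y}, f x := by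
          rw [pow_succ', ih, sum_mul]
          refine sum_congr rfl fun y _ => ?_
          rw [mul_sum]
          refine sum_congr rfl fun T _ => ?_
          rw [prod_symmDiff_singleton hf]
          ring
      _ = _ := by
          simp only [h]
          rw [sum_comm]
          refine sum_congr rfl fun T _ => ?_
          rw [← sum_mul, sum_parityWordCount_symmDiff]

variable {F : Type*} [Field F]

/-- A set of at most six elements of even size whose first, third and fifth power sums vanish is
empty in characteristic two. -/
theorem eq_empty_of_power_sums [CharP F 2] {T : Finset F} (hcard : #T ≤ 6) (heven : Even #T)
    (h1 : ∑ v ∈ T, v = 0) (h3 : ∑ v ∈ T, v ^ 3 = 0) (h5 : ∑ v ∈ T, v ^ 5 = 0) : T = ∅ := by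
  have hsq : ∀ k, ∑ v ∈ T, v ^ k = 0 → ∑ v ∈ T, v ^ (2 * k) = 0 := by
    intro k hk
    have : (∑ v ∈ T, v ^ k) ^ 2 = ∑ v ∈ T, (v ^ k) ^ 2 := sum_pow_char 2 T fun v => v ^ k
    rw [hk] at this
    simpa [← pow_mul, mul_comm] using this.symm
  have h1' : ∑ v ∈ T, v ^ 1 = 0 := by simpa using h1
  -- Exponent 0 is the parity of the size, and exponents 2 and 4 come from squaring. The all-ones
  -- vector is then killed by an invertible Vandermonde matrix.
  have hall : ∀ k < 6, ∑ v ∈ T, v ^ k = 0 := by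
    intro k hk
    interval_cases k
    · simp only [pow_zero, sum_const, nsmul_eq_mul, mul_one]
      exact (CharP.cast_eq_zero_iff F 2 _).2 heven.two_dvd
    · exact h1'
    · exact hsq 1 h1'
    · exact h3
    · exact hsq 2 (hsq 1 h1')
    · exact h5
  have hv := Matrix.eq_zero_of_forall_pow_sum_mul_pow_eq_zero (R := F) (n := #T)
    (f := fun i => (T.equivFin.symm i : F)) (v := fun _ => 1)
    (Subtype.val_injective.comp T.equivFin.symm.injective) (fun i => by
      simp only [one_mul]
      rw [Equiv.sum_comp T.equivFin.symm (fun x : T => (x : F) ^ (i : ℕ)),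
        sum_coe_sort T fun x => x ^ (i : ℕ)]
      exact hall i (by omega))
  by_contra hne
  have hpos : 0 < #T := card_pos.2 (nonempty_iff_ne_empty.2 hne)
  exact one_ne_zero (congrFun hv ⟨0, hpos⟩)

variable [Fintype F] [Algebra (ZMod 2) F]

/-- The product is a character of (a, b, c) whose coefficients are the three power sums of `T`, so
orthogonality applies in each variable. -/
theorem sum_prod_traceSign [DecidableEq F] (T : Finset F) :
    ∑ p : F × F × F, ∏ x ∈ T, traceSign (p.1 * x ^ 5 + p.2.1 * x ^ 3 + p.2.2 * x) =
      if ∑ x ∈ T, x = 0 ∧ ∑ x ∈ T, x ^ 3 = 0 ∧ ∑ x ∈ T, x ^ 5 = 0 then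
        (Fintype.card F : ℤ) ^ 3 else 0 := by
  have h : ∀ p : F × F × F, ∏ x ∈ T, traceSign (p.1 * x ^ 5 + p.2.1 * x ^ 3 + p.2.2 * x) =
      traceSign ((∑ x ∈ T, x ^ 5) * p.1) * (traceSign ((∑ x ∈ T, x ^ 3) * p.2.1) *
        traceSign ((∑ x ∈ T, x) * p.2.2)) := by
    intro p
    rw [← traceSign_sum, ← traceSign_add, ← traceSign_add]
    rw [sum_add_distrib, sum_add_distrib, ← mul_sum, ← mul_sum, ← mul_sum]
    congr 1
    ring
  simp only [h, Fintype.sum_prod_type, ← mul_sum, sum_traceSign_mul, ← sum_mul]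
  split_ifs <;> first | (exfalso; tauto) | ring

/-- The even power moments up to order six of the exponential sums. -/
theorem sum_quinticSum_pow [CharP F 2] {n : ℕ} (hn : n ≤ 6) (heven : Even n) :
    ∑ p : F × F × F, quinticSum p.1 p.2.1 p.2.2 ^ n =
      (Fintype.card F : ℤ) ^ 3 * parityWordCount (Fintype.card F) n 0 := by
  classical
  simp only [quinticSum, sum_sign_pow fun x => traceSign_mul_self _]
  rw [sum_comm]
  simp only [← mul_sum, sum_prod_traceSign]
  -- Any other `T` drops out by its size, by its parity, or because its power sums cannot all
  -- vanish.
  rw [sum_eq_single ∅]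
  · simp [mul_comm]
  · intro T _ hT
    by_cases h : n < #T
    · rw [parityWordCount_eq_zero_of_lt _ h, zero_mul]
    by_cases h' : Odd (n + #T)
    · rw [parityWordCount_eq_zero_of_odd _ h', zero_mul]
    rw [if_neg, mul_zero]
    rintro ⟨h1, h3, h5⟩
    refine hT (eq_empty_of_power_sums (by omega) ?_ h1 h3 h5)
    rw [Nat.not_odd_iff_even, Nat.even_add] at h'
    exact h'.1 heven
  · simp

/-- The number of nonzero coefficient triples whose exponential sum has the given square. -/
noncomputable def quinticSumSqCount (F : Type*) [Field F] [Fintype F] [Algebra (ZMod 2) F]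
    (v : ℤ) : ℕ :=
  {p : F × F × F | p ≠ 0 ∧ quinticSum p.1 p.2.1 p.2.2 ^ 2 = v ^ 2}.ncard

theorem quinticSum_zero : quinticSum (0 : F) 0 0 = Fintype.card F := by
  simp [quinticSum, traceSign_zero]

/-- The zero triple contributes q^(2k); the others are grouped by their four possible squares. The
factor `0 ^ k` keeps the vanishing sums in the case k = 0 only. -/
theorem sum_over_quinticSumSqCount [CharP F 2] {s : ℕ} (hF : Fintype.card F = 2 ^ (2 * s)) (k : ℕ) :
    ∑ p : F × F × F, quinticSum p.1 p.2.1 p.2.2 ^ (2 * k) =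
      (Fintype.card F : ℤ) ^ (2 * k) + 0 ^ k * quinticSumSqCount F 0 +
      Fintype.card F ^ k * (quinticSumSqCount F (2 ^ s) +
        4 ^ k * quinticSumSqCount F (2 * 2 ^ s) + 16 ^ k * quinticSumSqCount F (4 * 2 ^ s)) := by
  classical
  have hq : (Fintype.card F : ℤ) = (2 ^ s) ^ 2 := by rw [hF]; push_cast; ring
  have hcount : ∀ v : ℤ, (quinticSumSqCount F v : ℤ) =
      ∑ p ∈ univ.erase (0 : F × F × F),
        if quinticSum p.1 p.2.1 p.2.2 ^ 2 = v ^ 2 then 1 else 0 := by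
    intro v
    rw [sum_boole, quinticSumSqCount, Set.ncard_eq_toFinset_card']
    congr 2
    ext p
    simp
  rw [← add_sum_erase univ _ (mem_univ (0 : F × F × F))]
  simp only [Prod.fst_zero, Prod.snd_zero, quinticSum_zero]
  rw [add_assoc]
  congr 1
  simp only [hcount, mul_sum, ← sum_add_distrib]
  refine sum_congr rfl fun p hp => ?_
  have hpos : (0 : ℤ) < (2 ^ s) ^ 2 := by positivity
  have key := quinticSum_sq_mem hF (ne_of_mem_erase hp)
  rw [pow_mul, hq]
  simp only [show ((2 : ℤ) * 2 ^ s) ^ 2 = 4 * (2 ^ s) ^ 2 by ring,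
    show ((4 : ℤ) * 2 ^ s) ^ 2 = 16 * (2 ^ s) ^ 2 by ring,
    show (0 : ℤ) ^ 2 = 0 by norm_num] at key ⊢
  generalize ((2 : ℤ) ^ s) ^ 2 = Q at *
  generalize quinticSum p.1 p.2.1 p.2.2 ^ 2 = X at *
  rcases key with rfl | rfl | rfl | rfl <;> split_ifs <;>
    first | (exfalso; omega) | simp [mul_pow, mul_comm]

end Moments

/-! ### Value distribution of the exponential sums -/

section ValueDistribution

variable {F : Type*} [Field F] [Fintype F] [Algebra (ZMod 2) F]

/-- The power moments as linear equations for the value distribution. -/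
theorem quinticSumSqCount_moments [CharP F 2] {s : ℕ} (hF : Fintype.card F = 2 ^ (2 * s)) {q : ℚ}
    (hq : (Fintype.card F : ℚ) = q) :
    (quinticSumSqCount F 0 + quinticSumSqCount F (2 ^ s) + quinticSumSqCount F (2 * 2 ^ s) +
      quinticSumSqCount F (4 * 2 ^ s) : ℚ) = q ^ 3 - 1 ∧
    (quinticSumSqCount F (2 ^ s) + 4 * quinticSumSqCount F (2 * 2 ^ s) +
      16 * quinticSumSqCount F (4 * 2 ^ s) : ℚ) = q ^ 3 - q ∧
    (quinticSumSqCount F (2 ^ s) + 16 * quinticSumSqCount F (2 * 2 ^ s) +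
      256 * quinticSumSqCount F (4 * 2 ^ s) : ℚ) = 3 * q ^ 3 - 3 * q ^ 2 ∧
    (quinticSumSqCount F (2 ^ s) + 64 * quinticSumSqCount F (2 * 2 ^ s) +
      4096 * quinticSumSqCount F (4 * 2 ^ s) : ℚ) = 14 * q ^ 3 - 30 * q ^ 2 + 16 * q := by
  have hq0 : q ≠ 0 := hq ▸ Nat.cast_ne_zero.2 Fintype.card_ne_zero
  have m0 := sum_over_quinticSumSqCount hF 0
  have m1 := (sum_over_quinticSumSqCount hF 1).symm.trans
    (sum_quinticSum_pow (F := F) (n := 2) (by norm_num) (by decide))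
  have m2 := (sum_over_quinticSumSqCount hF 2).symm.trans
    (sum_quinticSum_pow (F := F) (n := 4) (by norm_num) (by decide))
  have m3 := (sum_over_quinticSumSqCount hF 3).symm.trans
    (sum_quinticSum_pow (F := F) (n := 6) (by norm_num) (by decide))
  rw [parityWordCount_two_zero] at m1
  rw [parityWordCount_four_zero] at m2
  rw [parityWordCount_six_zero] at m3
  have m0' := congrArg (Int.cast : ℤ → ℚ) m0
  have m1' := congrArg (Int.cast : ℤ → ℚ) m1
  have m2' := congrArg (Int.cast : ℤ → ℚ) m2
  have m3' := congrArg (Int.cast : ℤ → ℚ) m3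
  simp only [mul_zero, pow_zero, sum_const, card_univ, Fintype.card_prod, nsmul_eq_mul] at m0'
  push_cast at m0' m1' m2' m3'
  simp only [hq] at m0' m1' m2' m3'
  refine ⟨by linarith, ?_, ?_, ?_⟩
  · apply mul_left_cancel₀ hq0
    linarith
  · apply mul_left_cancel₀ (pow_ne_zero 2 hq0)
    linarith
  · apply mul_left_cancel₀ (pow_ne_zero 3 hq0)
    linarith

/-- The three positive-order moment equations have Vandermonde-type coefficients in the nodes 1, 4,
16, so they determine the three nonzero frequencies linearly. -/
theorem quinticSumSqCount_four_mul [CharP F 2] {s : ℕ} (hF : Fintype.card F = 2 ^ (2 * s)) {q : ℚ}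
    (hq : (Fintype.card F : ℚ) = q) :
    (quinticSumSqCount F (4 * 2 ^ s) : ℚ) = q * (q - 1) * (q - 4) / 960 := by
  obtain ⟨-, h1, h2, h3⟩ := quinticSumSqCount_moments hF hq
  linarith

theorem quinticSumSqCount_two_mul [CharP F 2] {s : ℕ} (hF : Fintype.card F = 2 ^ (2 * s)) {q : ℚ}
    (hq : (Fintype.card F : ℚ) = q) :
    (quinticSumSqCount F (2 * 2 ^ s) : ℚ) = 7 * q ^ 2 * (q - 1) / 48 := by
  obtain ⟨-, h1, h2, h3⟩ := quinticSumSqCount_moments hF hq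
  linarith

theorem quinticSumSqCount_two_pow [CharP F 2] {s : ℕ} (hF : Fintype.card F = 2 ^ (2 * s)) {q : ℚ}
    (hq : (Fintype.card F : ℚ) = q) :
    (quinticSumSqCount F (2 ^ s) : ℚ) = 2 * q * (q - 1) * (3 * q + 8) / 15 := by
  obtain ⟨-, h1, h2, h3⟩ := quinticSumSqCount_moments hF hq
  linarith

theorem quinticSumSqCount_zero [CharP F 2] {s : ℕ} (hF : Fintype.card F = 2 ^ (2 * s)) {q : ℚ}
    (hq : (Fintype.card F : ℚ) = q) :
    (quinticSumSqCount F 0 : ℚ) = q ^ 3 - 1 - 2 * q * (q - 1) * (3 * q + 8) / 15 -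
      7 * q ^ 2 * (q - 1) / 48 - q * (q - 1) * (q - 4) / 960 := by
  obtain ⟨h0, h1, h2, h3⟩ := quinticSumSqCount_moments hF hq
  linarith

end ValueDistribution

/-! ### Weights of the code -/

section Weights

variable {F : Type*} [Field F] [Algebra (ZMod 2) F]

/-- The word `(Tr(a x⁵ + b x³ + c x) + h)_x` for `p = (a, b, c)`. -/
noncomputable def traceWord (p : F × F × F) (h : ZMod 2) : F → ZMod 2 :=
  fun x => Algebra.trace (ZMod 2) F (p.1 * x ^ 5 + p.2.1 * x ^ 3 + p.2.2 * x) + h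

theorem mem_bchTraceCode {w : F → ZMod 2} :
    w ∈ bchTraceCode F ↔ ∃ p h, w = traceWord p h := by
  constructor
  · rintro ⟨a, b, c, h, rfl⟩
    exact ⟨(a, b, c), h, rfl⟩
  · rintro ⟨p, h, rfl⟩
    exact ⟨p.1, p.2.1, p.2.2, h, rfl⟩

theorem traceWord_sub (p p' : F × F × F) (h h' : ZMod 2) :
    traceWord (p - p') (h - h') = traceWord p h - traceWord p' h' := by
  funext x
  simp only [traceWord, Pi.sub_apply, Prod.fst_sub, Prod.snd_sub, sub_mul, map_add, map_sub]
  ring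

variable [Fintype F]

theorem hammingNorm_traceWord (p : F × F × F) (h : ZMod 2) :
    2 * (hammingNorm (traceWord p h) : ℤ) =
      Fintype.card F - binarySign h * quinticSum p.1 p.2.1 p.2.2 := by
  have := sum_binarySign_eq (traceWord p h)
  simp only [traceWord, binarySign_add, ← sum_mul] at this
  change quinticSum p.1 p.2.1 p.2.2 * _ = _ at this
  change _ = (Fintype.card F : ℤ) - 2 * (hammingNorm (traceWord p h) : ℤ) at this
  linarith

variable [CharP F 2] {s : ℕ}

theorem abs_quinticSum_le (hF : Fintype.card F = 2 ^ (2 * s)) {p : F × F × F} (hp : p ≠ 0) :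
    |quinticSum p.1 p.2.1 p.2.2| ≤ 4 * 2 ^ s := by
  apply abs_le_of_sq_le_sq _ (by positivity)
  have hpos : (0 : ℤ) < 2 ^ s := by positivity
  rcases quinticSum_sq_mem hF hp with h | h | h | h <;> rw [h] <;> nlinarith

/-- Every nonzero codeword has weight at least two. -/
theorem two_le_hammingNorm (hs : 3 ≤ s) (hF : Fintype.card F = 2 ^ (2 * s)) {p : F × F × F}
    {h : ZMod 2} (hne : hammingNorm (traceWord p h) ≠ 0 ∨ p ≠ 0) :
    2 ≤ hammingNorm (traceWord p h) := by
  have hw := hammingNorm_traceWord p h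
  have hq : (Fintype.card F : ℤ) = 2 ^ s * 2 ^ s := by rw [hF]; push_cast; ring
  have h8 : (8 : ℤ) ≤ 2 ^ s := by
    calc (8 : ℤ) = 2 ^ 3 := by norm_num
      _ ≤ 2 ^ s := pow_le_pow_right₀ (by norm_num) hs
  by_cases hp : p = 0
  · subst hp
    simp only [Prod.fst_zero, Prod.snd_zero, quinticSum_zero] at hw
    rcases binarySign_eq_one_or h with e | e <;> rw [e] at hw
    · exfalso
      rcases hne with h0 | h0
      · apply h0; omega
      · exact h0 rfl
    · have : (2 : ℤ) ≤ Fintype.card F := by rw [hq]; nlinarith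
      omega
  · have hS := abs_le.1 (abs_quinticSum_le hF hp)
    have : binarySign h * quinticSum p.1 p.2.1 p.2.2 ≤ 4 * 2 ^ s := by
      rcases binarySign_eq_one_or h with e | e <;> rw [e] <;> linarith [hS.1, hS.2]
    have : (4 : ℤ) ≤ 2 * hammingNorm (traceWord p h) := by rw [hw, hq]; nlinarith
    omega

theorem traceWord_injective (hs : 3 ≤ s) (hF : Fintype.card F = 2 ^ (2 * s)) :
    Function.Injective fun r : (F × F × F) × ZMod 2 => traceWord r.1 r.2 := by
  rintro ⟨p, h⟩ ⟨p', h'⟩ e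
  have h0 : traceWord (p - p') (h - h') = 0 := by
    rw [traceWord_sub]; exact sub_eq_zero.2 e
  have hp : p - p' = 0 := by
    by_contra hp
    have := two_le_hammingNorm hs hF (h := h - h') (.inr hp)
    rw [h0] at this
    simp at this
  have hh : h - h' = 0 := by
    have := congrFun h0 0
    simpa [hp, traceWord] using this
  rw [sub_eq_zero.1 hp, sub_eq_zero.1 hh]

theorem weightCount_eq_ncard (hs : 3 ≤ s) (hF : Fintype.card F = 2 ^ (2 * s)) {i : ℕ} {v : ℤ}
    (hi : 2 * (i : ℤ) = Fintype.card F - v) :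
    weightCount (bchTraceCode F) i =
      {r : (F × F × F) × ZMod 2 |
        binarySign r.2 * quinticSum r.1.1 r.1.2.1 r.1.2.2 = v}.ncard := by
  rw [← Set.ncard_image_of_injective _ (traceWord_injective hs hF), weightCount]
  congr 1
  ext w
  simp only [Set.mem_ofPred_eq, Set.mem_image, mem_bchTraceCode]
  constructor
  · rintro ⟨⟨p, h, rfl⟩, hw⟩
    refine ⟨(p, h), ?_, rfl⟩
    have := hammingNorm_traceWord p h
    rw [hw] at this
    linarith
  · rintro ⟨⟨p, h⟩, hv, rfl⟩
    refine ⟨⟨p, h, rfl⟩, ?_⟩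
    have := hammingNorm_traceWord p h
    dsimp only at hv ⊢
    rw [hv] at this
    omega

/-- For v ≠ 0, each triple with S² = v² has exactly one constant `h` giving the sign of v. The zero
triple has S = q and is excluded by `hvq`. -/
theorem weightCount_eq_quinticSumSqCount (hs : 3 ≤ s) (hF : Fintype.card F = 2 ^ (2 * s)) {i : ℕ}
    {v : ℤ} (hv : v ≠ 0) (hvq : v ^ 2 ≠ (Fintype.card F : ℤ) ^ 2)
    (hi : 2 * (i : ℤ) = Fintype.card F - v) :
    weightCount (bchTraceCode F) i = quinticSumSqCount F v := by
  rw [weightCount_eq_ncard hs hF hi, quinticSumSqCount]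
  have hinj : Set.InjOn Prod.fst {r : (F × F × F) × ZMod 2 |
      binarySign r.2 * quinticSum r.1.1 r.1.2.1 r.1.2.2 = v} := by
    rintro ⟨p, h⟩ hr ⟨p', h'⟩ hr' (rfl : p = p')
    simp only [Set.mem_ofPred_eq] at hr hr'
    have hS : quinticSum p.1 p.2.1 p.2.2 ≠ 0 := by
      intro h0; apply hv; rw [← hr, h0, mul_zero]
    have hb := mul_right_cancel₀ hS (hr.trans hr'.symm)
    have : ∀ g g' : ZMod 2, binarySign g = binarySign g' → g = g' := by decide
    rw [this h h' hb]
  rw [← hinj.ncard_image]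
  congr 1
  ext p
  simp only [Set.mem_ofPred_eq, Set.mem_image]
  constructor
  · rintro ⟨r, hr, rfl⟩
    have hsq : quinticSum r.1.1 r.1.2.1 r.1.2.2 ^ 2 = v ^ 2 := by
      rw [← hr, mul_pow, sq (binarySign r.2), binarySign_mul_self, one_mul]
    refine ⟨?_, hsq⟩
    intro h0
    apply hvq
    rw [← hsq, h0]
    simp [quinticSum_zero]
  · rintro ⟨-, hsq⟩
    rcases sq_eq_sq_iff_eq_or_eq_neg.1 hsq with h | h
    · exact ⟨(p, 0), by simp [binarySign, h], rfl⟩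
    · exact ⟨(p, 1), by simp [binarySign, h], rfl⟩

/-- When S = 0 both constants give weight q/2, hence the factor 2. -/
theorem weightCount_half (hs : 3 ≤ s) (hF : Fintype.card F = 2 ^ (2 * s)) {i : ℕ}
    (hi : 2 * (i : ℤ) = Fintype.card F) :
    weightCount (bchTraceCode F) i = 2 * quinticSumSqCount F 0 := by
  rw [weightCount_eq_ncard hs hF (v := 0) (by linarith), quinticSumSqCount]
  have : {r : (F × F × F) × ZMod 2 |
      binarySign r.2 * quinticSum r.1.1 r.1.2.1 r.1.2.2 = 0} =
      {p : F × F × F | p ≠ 0 ∧ quinticSum p.1 p.2.1 p.2.2 ^ 2 = 0 ^ 2} ×ˢ Set.univ := by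
    ext ⟨p, h⟩
    have hb : binarySign h ≠ 0 := by revert h; decide
    simp only [Set.mem_ofPred_eq, Set.mem_prod, Set.mem_univ, and_true, mul_eq_zero, hb, false_or,
      ne_eq, OfNat.ofNat_ne_zero, not_false_eq_true, zero_pow, pow_eq_zero_iff]
    refine ⟨fun h0 => ⟨?_, h0⟩, fun h0 => h0.2⟩
    rintro rfl
    simp [quinticSum_zero] at h0
  rw [this, Set.ncard_prod, Set.ncard_univ, Nat.card_eq_fintype_card, ZMod.card, mul_comm]

end Weights

/-! ### Affine invariance -/

section AffineInvariance

variable {F : Type*} [Field F] [Fintype F]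

theorem coordLabel_bijective {α : Fˣ} (hα : ∀ x : Fˣ, x ∈ Subgroup.zpowers α) :
    Function.Bijective (coordLabel α (Fintype.card F - 1)) := by
  have hcard : 0 < Fintype.card F := Fintype.card_pos
  have h1 : 1 < Fintype.card F := Fintype.one_lt_card
  have hpow : α ^ (Fintype.card F - 1) = 1 := by
    ext
    simpa using FiniteField.pow_card_sub_one_eq_one (α : F) α.ne_zero
  refine (Fintype.bijective_iff_surjective_and_card _).2 ⟨fun x => ?_, by simp; omega⟩
  by_cases hx : x = 0
  · exact ⟨Fin.last _, by simp [coordLabel, hx]⟩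
  · obtain ⟨k, hk⟩ := mem_powers_iff_mem_zpowers.2 (hα (Units.mk0 x hx))
    refine ⟨Fin.castSucc ⟨k % (Fintype.card F - 1), Nat.mod_lt _ (by omega)⟩, ?_⟩
    have hk' : α ^ (k % (Fintype.card F - 1)) = Units.mk0 x hx := by
      rw [← pow_eq_pow_mod k hpow]; exact hk
    rw [coordLabel, Fin.snoc_castSucc]
    simpa using congrArg Units.val hk'

variable [Algebra (ZMod 2) F] [CharP F 2]

theorem bchTraceCode_comp_affine {w : F → ZMod 2} (hw : w ∈ bchTraceCode F) (u v : F) :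
    (fun x => w (u * x + v)) ∈ bchTraceCode F := by
  obtain ⟨a, b, c, h, rfl⟩ := hw
  -- Fourth and square roots of the coefficients of x⁴ and x²: since Tr((ex)⁴) = Tr(ex) and
  -- Tr((fx)²) = Tr(fx), these terms join the linear one.
  obtain ⟨e, he⟩ := (pow_two_pow_bijective (F := F) 2).2 (a * u ^ 4 * v)
  obtain ⟨f, hf⟩ := (pow_two_pow_bijective (F := F) 1).2 (b * u ^ 2 * v)
  norm_num at he hf
  refine ⟨a * u ^ 5, b * u ^ 3, e + f + a * v ^ 4 * u + b * u * v ^ 2 + c * u,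
    h + Algebra.trace (ZMod 2) F (a * v ^ 5 + b * v ^ 3 + c * v), ?_⟩
  funext x
  have h2 : (u * x + v) ^ 2 = (u * x) ^ 2 + v ^ 2 := add_pow_char _ _ 2
  have h4 : (u * x + v) ^ 4 = (u * x) ^ 4 + v ^ 4 := add_pow_char_pow _ _ 2 2
  have expand : a * (u * x + v) ^ 5 + b * (u * x + v) ^ 3 + c * (u * x + v) =
      (a * u ^ 5 * x ^ 5 + b * u ^ 3 * x ^ 3 + (a * v ^ 4 * u + b * u * v ^ 2 + c * u) * x) +
      (e * x) ^ 4 + (f * x) ^ 2 + (a * v ^ 5 + b * v ^ 3 + c * v) := by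
    rw [show (u * x + v) ^ 5 = (u * x + v) ^ 4 * (u * x + v) by ring,
      show (u * x + v) ^ 3 = (u * x + v) ^ 2 * (u * x + v) by ring, h2, h4,
      mul_pow e, mul_pow f, he, hf]
    ring
  beta_reduce
  rw [expand, map_add, map_add, map_add, trace_pow_four, trace_sq, add_comm h, ← add_assoc,
    ← map_add, ← map_add]
  rw [show a * u ^ 5 * x ^ 5 + b * u ^ 3 * x ^ 3 +
      (e + f + a * v ^ 4 * u + b * u * v ^ 2 + c * u) * x =
      a * u ^ 5 * x ^ 5 + b * u ^ 3 * x ^ 3 + (a * v ^ 4 * u + b * u * v ^ 2 + c * u) * x +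
        e * x + f * x by ring]

theorem affineGroup_subset_PAut :
    affineGroup F ⊆ (PAut (bchTraceCode F) : Set (Equiv.Perm F)) := by
  rintro σ ⟨u, v, hu, hσ⟩ w
  constructor
  · intro hw
    have := bchTraceCode_comp_affine hw u⁻¹ (-(u⁻¹ * v))
    convert this using 1
    funext x
    simp only [Function.comp_apply, hσ]
    congr 1
    field_simp
    ring
  · intro hw
    have := bchTraceCode_comp_affine hw u v
    convert this using 1
    funext x
    simp only [Function.comp_apply, hσ]

/-- The sums of x, x³ and x⁵ over the field vanish since the exponents are below q - 1; the constant
is added q times, an even number. -/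
theorem sum_codeword_eq_zero (h64 : 64 ≤ Fintype.card F) {w : F → ZMod 2}
    (hw : w ∈ bchTraceCode F) : ∑ x, w x = 0 := by
  obtain ⟨a, b, c, h, rfl⟩ := hw
  have hsum : ∀ k, k < 6 → ∑ x : F, x ^ k = 0 := fun k hk =>
    FiniteField.sum_pow_lt_card_sub_one F k (by omega)
  have h1 : ∑ x : F, x = 0 := by simpa using hsum 1 (by norm_num)
  rw [sum_add_distrib, ← map_sum, sum_add_distrib, sum_add_distrib, ← mul_sum, ← mul_sum,
    ← mul_sum, h1, hsum 3 (by norm_num), hsum 5 (by norm_num)]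
  have h2 : 2 ∣ Fintype.card F := by
    have : (Fintype.card F : F) = 0 := FiniteField.cast_card_eq_zero F
    exact (CharP.cast_eq_zero_iff F 2 _).1 this
  have h2' : (Fintype.card F : ZMod 2) = 0 := (CharP.cast_eq_zero_iff (ZMod 2) 2 _).2 h2
  simp [h2']

/-- The cyclic code is the puncturing at 0. Multiplication by α acts as the shift, and even parity
recovers the deleted coordinate. -/
theorem isExtendedCyclic_bchTraceCode (h64 : 64 ≤ Fintype.card F) {α : Fˣ}
    (hα : ∀ x : Fˣ, x ∈ Subgroup.zpowers α) : IsExtendedCyclic α (bchTraceCode F) := by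
  have hpow : (α : F) ^ (Fintype.card F - 1) = 1 :=
    FiniteField.pow_card_sub_one_eq_one (α : F) α.ne_zero
  have hbij := coordLabel_bijective hα
  have hpos : 1 < Fintype.card F - 1 := by omega
  unfold IsExtendedCyclic
  generalize Fintype.card F - 1 = n at *
  have hsum : ∀ c : F → ZMod 2, ∑ i, (c ∘ coordLabel α n) i = ∑ x, c x := fun c =>
    hbij.sum_comp c
  have hcast : ∀ i : Fin n, coordLabel α n i.castSucc = (α : F) ^ (i : ℕ) := fun i => by
    rw [coordLabel, Fin.snoc_castSucc]
  refine ⟨(bchTraceCode F).map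
    (LinearMap.funLeft (ZMod 2) (ZMod 2) fun i : Fin n => (α : F) ^ (i : ℕ)), ?_, ?_⟩
  · rintro _ ⟨w, hw, rfl⟩
    refine ⟨_, bchTraceCode_comp_affine hw α 0, ?_⟩
    funext i
    simp only [LinearMap.funLeft_apply]
    congr 1
    obtain ⟨n, rfl⟩ : ∃ k, n = k + 1 := ⟨n - 1, by omega⟩
    rw [finRotate_apply, Fin.val_add, ← pow_eq_pow_mod _ hpow, pow_add, Fin.val_one']
    rw [← pow_eq_pow_mod _ hpow]
    ring
  · intro c
    constructor
    · intro hc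
      refine ⟨⟨c, hc, ?_⟩, ?_⟩
      · funext i
        simp [LinearMap.funLeft_apply, hcast]
      · rw [hsum, sum_codeword_eq_zero h64 hc]
    · rintro ⟨⟨w, hw, hwc⟩, hc⟩
      have heq : ∀ i : Fin n, w (coordLabel α n i.castSucc) = c (coordLabel α n i.castSucc) := by
        intro i
        have := congrFun hwc i
        simpa [LinearMap.funLeft_apply, hcast] using this
      have hw0 := sum_codeword_eq_zero h64 hw
      rw [← hsum, Fin.sum_univ_castSucc] at hw0
      rw [Fin.sum_univ_castSucc] at hc
      simp only [Function.comp_apply] at hw0 hc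
      rw [sum_congr rfl fun i _ => heq i, ← hc] at hw0
      have hlast := add_left_cancel hw0
      have : w = c := by
        funext x
        obtain ⟨i, rfl⟩ := hbij.2 x
        induction i using Fin.lastCases with
        | last => exact hlast
        | cast i => exact heq i
      exact this ▸ hw

end AffineInvariance

/-! ### Designs from codes with a doubly transitive automorphism group -/

section Designs

theorem wordSupport_injective {ι : Type*} [Fintype ι] :
    Function.Injective (wordSupport : (ι → ZMod 2) → Finset ι) := by
  intro c d h
  funext x
  have hx : c x ≠ 0 ↔ d x ≠ 0 := by
    have := Finset.ext_iff.1 h x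
    simpa [wordSupport] using this
  have : ∀ g g' : ZMod 2, (g ≠ 0 ↔ g' ≠ 0) → g = g' := by decide
  exact this _ _ hx

variable {ι : Type*} [Fintype ι]

open Classical in
/-- The codewords of weight `i` whose supports contain both points. -/
noncomputable def wordsThrough (C : Submodule (ZMod 2) (ι → ZMod 2)) (i : ℕ) (x y : ι) :
    Finset (ι → ZMod 2) :=
  {c | (c ∈ C ∧ hammingNorm c = i) ∧ c x ≠ 0 ∧ c y ≠ 0}

theorem card_wordsThrough_perm {C : Submodule (ZMod 2) (ι → ZMod 2)} {σ : Equiv.Perm ι}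
    (hσ : σ ∈ PAut C) (i : ℕ) (x y : ι) :
    #(wordsThrough C i (σ x) (σ y)) = #(wordsThrough C i x y) := by
  classical
  have hnorm : ∀ c : ι → ZMod 2, hammingNorm (c ∘ σ) = hammingNorm c := by
    intro c
    unfold hammingNorm
    exact card_bij (fun x _ => σ x) (by simp) (fun x _ y _ h => σ.injective h)
      (fun y hy => ⟨σ.symm y, by simpa using hy, by simp⟩)
  refine card_bij (fun c _ => c ∘ σ) ?_ ?_ ?_
  · intro c hc
    simp only [wordsThrough, mem_filter, mem_univ, true_and] at hc ⊢
    exact ⟨⟨(hσ c).2 hc.1.1, (hnorm c).trans hc.1.2⟩, hc.2⟩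
  · intro c _ d _ h
    exact σ.surjective.injective_comp_right h
  · intro d hd
    simp only [wordsThrough, mem_filter, mem_univ, true_and] at hd
    have e : (d ∘ σ.symm) ∘ σ = d := by funext z; simp
    refine ⟨d ∘ σ.symm, ?_, e⟩
    simp only [wordsThrough, mem_filter, mem_univ, true_and]
    refine ⟨⟨?_, ?_⟩, by simpa using hd.2⟩
    · rw [← hσ, e]; exact hd.1.1
    · rw [← hnorm, e]; exact hd.1.2

/-- Double counting of codewords of weight i with ordered pairs of distinct points of their
supports. -/
theorem sum_card_wordsThrough [DecidableEq ι] (C : Submodule (ZMod 2) (ι → ZMod 2)) (i : ℕ) :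
    ∑ z ∈ (univ : Finset ι).offDiag, #(wordsThrough C i z.1 z.2) =
      weightCount C i * (i * (i - 1)) := by
  classical
  let W : Finset (ι → ZMod 2) := {c | c ∈ C ∧ hammingNorm c = i}
  have hW : weightCount C i = #W := by
    rw [weightCount, Set.ncard_eq_toFinset_card']
    congr 1
    ext c
    simp [W]
  have hcount : ∀ c ∈ W, #{z ∈ (univ : Finset ι).offDiag | c z.1 ≠ 0 ∧ c z.2 ≠ 0} =
      i * (i - 1) := by
    intro c hc
    have hi : #(wordSupport c) = i := (mem_filter.1 hc).2.2
    have : ({z ∈ (univ : Finset ι).offDiag | c z.1 ≠ 0 ∧ c z.2 ≠ 0} : Finset (ι × ι)) =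
        (wordSupport c).offDiag := by
      ext z
      simp only [mem_filter, mem_offDiag, mem_univ, true_and, wordSupport]
      tauto
    rw [this, offDiag_card, hi, Nat.mul_sub_one]
  have hN : ∀ x y, #(wordsThrough C i x y) = #{c ∈ W | c x ≠ 0 ∧ c y ≠ 0} := by
    intro x y
    congr 1
    ext c
    simp [wordsThrough, W]
  simp only [hN, hW]
  rw [← smul_eq_mul, ← sum_const, ← sum_congr rfl hcount]
  simp only [card_filter]
  exact sum_comm

variable {F : Type*} [Field F] [Fintype F]

theorem card_wordsThrough_eq {C : Submodule (ZMod 2) (F → ZMod 2)}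
    (hC : affineGroup F ⊆ (PAut C : Set (Equiv.Perm F))) (i : ℕ) {x y : F} (hxy : x ≠ y) :
    #(wordsThrough C i x y) = #(wordsThrough C i 0 1) := by
  have hyx : y - x ≠ 0 := sub_ne_zero.2 hxy.symm
  let σ : Equiv.Perm F := (Equiv.mulLeft₀ (y - x) hyx).trans (Equiv.addRight x)
  have hσ : ∀ z, σ z = (y - x) * z + x := fun z => rfl
  have := card_wordsThrough_perm (hC ⟨y - x, x, hyx, hσ⟩) i 0 1
  rwa [hσ, hσ, mul_zero, zero_add, mul_one, sub_add_cancel] at this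

/-- The codewords of a fixed weight of an affine-invariant code hold a 2-design. -/
theorem exists_isTDesign {C : Submodule (ZMod 2) (F → ZMod 2)}
    (hC : affineGroup F ⊆ (PAut C : Set (Equiv.Perm F))) {i : ℕ} (hi : 2 ≤ i)
    (hA : weightCount C i ≠ 0) :
    ∃ l : ℕ, IsTDesign (supportBlocks C i) 2 (Fintype.card F) i l ∧
      l * (Fintype.card F * (Fintype.card F - 1)) = weightCount C i * (i * (i - 1)) := by
  classical
  refine ⟨#(wordsThrough C i 0 1), ⟨rfl, by norm_num, hi, ?_, ?_, ?_⟩, ?_⟩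
  · obtain ⟨c, hc⟩ := Set.nonempty_of_ncard_ne_zero hA
    exact hc.2 ▸ hammingNorm_le_card_fintype
  · rintro b ⟨c, -, hc, rfl⟩
    exact hc
  · intro T hT
    obtain ⟨x, y, hxy, rfl⟩ := card_eq_two.1 hT
    rw [← card_wordsThrough_eq hC i hxy, ← Set.ncard_coe_finset,
      ← Set.ncard_image_of_injective _ wordSupport_injective]
    congr 1
    ext b
    simp only [supportBlocks, wordsThrough, Set.mem_ofPred_eq, Set.mem_image, mem_coe, mem_filter,
      mem_univ, true_and]
    constructor
    · rintro ⟨⟨c, hc, hw, rfl⟩, hb⟩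
      have hx := hb (mem_insert_self x {y})
      have hy := hb (mem_insert_of_mem (mem_singleton_self y))
      simp only [wordSupport, mem_filter, mem_univ, true_and] at hx hy
      exact ⟨c, ⟨⟨hc, hw⟩, hx, hy⟩, rfl⟩
    · rintro ⟨c, ⟨⟨hc, hw⟩, hx, hy⟩, rfl⟩
      refine ⟨⟨c, hc, hw, rfl⟩, fun z hz => ?_⟩
      rw [mem_insert, mem_singleton] at hz
      rcases hz with rfl | rfl <;> simpa [wordSupport]
  · rw [← sum_card_wordsThrough, sum_congr rfl fun z hz =>
      card_wordsThrough_eq hC i (mem_offDiag.1 hz).2.2, sum_const, offDiag_card, card_univ,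
      smul_eq_mul, Nat.mul_sub_one, mul_comm]

end Designs

/-! ### Parameters of the seven designs -/

section MainTheorem

variable {F : Type*} [Field F] [Fintype F] [Algebra (ZMod 2) F] [CharP F 2]

/-- The parameter of a design held by the code, from the number of codewords. -/
theorem exists_isTDesign_bchTraceCode {q : ℕ} (hF : Fintype.card F = q) {i : ℕ} {A μ : ℚ}
    (hA : (weightCount (bchTraceCode F) i : ℚ) = A) (hpos : 0 < A) (hi : 2 ≤ i)
    (hμ : A * ((i : ℚ) * (i - 1)) = μ * ((q : ℚ) * (q - 1))) :
    weightCount (bchTraceCode F) i ≠ 0 ∧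
      ∃ l : ℕ, (l : ℚ) = μ ∧ IsTDesign (supportBlocks (bchTraceCode F) i) 2 q i l := by
  have hne : weightCount (bchTraceCode F) i ≠ 0 := by
    intro h
    rw [h, Nat.cast_zero] at hA
    exact hpos.ne hA
  refine ⟨hne, ?_⟩
  obtain ⟨l, hd, hl⟩ := exists_isTDesign affineGroup_subset_PAut hi hne
  rw [hF] at hd hl
  refine ⟨l, ?_, hd⟩
  have hq : 1 < q := hF ▸ Fintype.one_lt_card
  have hq' : (1 : ℚ) < q := by exact_mod_cast hq
  have hl' := congrArg (Nat.cast : ℕ → ℚ) hl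
  push_cast [Nat.cast_sub hq.le, Nat.cast_sub (show 1 ≤ i by omega)] at hl'
  rw [hA, hμ] at hl'
  exact mul_right_cancel₀ (mul_ne_zero (by linarith) (by linarith)) hl'

/-- The designs held by the codewords whose weight differs from half the length. -/
theorem exists_isTDesign_offset {s t : ℕ} (hs : 3 ≤ s) (hF : Fintype.card F = 2 ^ (2 * s))
    (ht : 1 ≤ t) (hcard : Fintype.card F = t ^ 2 * 2 ^ 6) {i : ℕ} (k : ℤ) {A μ : ℚ} (hk : k ≠ 0)
    (hk16 : |k| ≤ 16) (hi : (i : ℤ) = 32 * t ^ 2 - k * t)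
    (hA : (quinticSumSqCount F (2 * k * t) : ℚ) = A) (hpos : 0 < A)
    (hμ : A * ((32 * t ^ 2 - k * t) * (32 * t ^ 2 - k * t - 1)) =
      μ * (64 * t ^ 2 * (64 * t ^ 2 - 1))) :
    weightCount (bchTraceCode F) i ≠ 0 ∧ ∃ l : ℕ, (l : ℚ) = μ ∧
      IsTDesign (supportBlocks (bchTraceCode F) i) 2 (t ^ 2 * 2 ^ 6) i l := by
  have htz : (1 : ℤ) ≤ t := by exact_mod_cast ht
  have htt : (t : ℤ) ≤ t ^ 2 := by nlinarith
  have hqz : (Fintype.card F : ℤ) = 64 * t ^ 2 := by rw [hcard]; push_cast; ring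
  have hiq : (i : ℚ) = 32 * t ^ 2 - k * t := by exact_mod_cast congrArg (Int.cast : ℤ → ℚ) hi
  refine exists_isTDesign_bchTraceCode hcard (A := A) ?_ hpos ?_ ?_
  · rw [← hA, weightCount_eq_quinticSumSqCount hs hF (v := 2 * k * t)]
    · positivity
    · intro h
      rw [hqz] at h
      -- v² = q² would force k² = 1024t², too large for |k| ≤ 16.
      have h' : (t : ℤ) ^ 2 * (k ^ 2 - 1024 * t ^ 2) = 0 := by linarith
      have hk2 : k ^ 2 ≤ 16 ^ 2 := sq_le_sq' (abs_le.1 hk16).1 (abs_le.1 hk16).2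
      rcases mul_eq_zero.1 h' with h0 | h0 <;> linarith
    · rw [hi, hqz]; ring
  · have hkt : k * t ≤ 16 * t := mul_le_mul_of_nonneg_right (abs_le.1 hk16).2 (by linarith)
    have : (2 : ℤ) ≤ i := by rw [hi]; linarith
    exact_mod_cast this
  · rw [hiq, hμ]
    push_cast
    ring

end MainTheorem

set_option maxHeartbeats 1000000 in
theorem theorem3p2 (s : ℕ) (hs : 3 ≤ s) (F : Type*) [Field F] [Fintype F] [Algebra (ZMod 2) F]
    (hF : Fintype.card F = 2 ^ (2 * s)) :
    (∀ α : Fˣ, (∀ x : Fˣ, x ∈ Subgroup.zpowers α) → IsAffineInvariant α (bchTraceCode F)) ∧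
    (∀ i : ℕ, i ≠ 0 → weightCount (bchTraceCode F) i ≠ 0 →
      ∃ l : ℕ, 0 < l ∧ IsTDesign (supportBlocks (bchTraceCode F) i) 2 (2 ^ (2 * s)) i l) ∧
    (∀ p ∈ ([
      (2 ^ (2 * s - 1),
        (29 * 2 ^ (6 * s - 5) - 33 * 2 ^ (4 * s - 5) + 17 * 2 ^ (2 * s - 3) - 2)
          * (2 ^ (2 * s - 1) - 1) / (2 * (2 ^ (2 * s) - 1))),
      (2 ^ (2 * s - 1) - 2 ^ (s - 1),
        2 / 15 * 2 ^ (s - 1) * (3 * 2 ^ (4 * s) + 5 * 2 ^ (2 * s) - 8)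
          * (2 ^ (2 * s - 1) - 2 ^ (s - 1) - 1) / (2 ^ s + 1)),
      (2 ^ (2 * s - 1) + 2 ^ (s - 1),
        2 / 15 * 2 ^ (s - 1) * (3 * 2 ^ (4 * s) + 5 * 2 ^ (2 * s) - 8)
          * (2 ^ (2 * s - 1) + 2 ^ (s - 1) - 1) / (2 ^ s - 1)),
      (2 ^ (2 * s - 1) - 2 ^ s,
        7 / 3 * 2 ^ (3 * s - 4) * (2 ^ (2 * s - 1) - 2 ^ s - 1) * (2 ^ (s - 1) - 1)),
      (2 ^ (2 * s - 1) + 2 ^ s,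
        7 / 3 * 2 ^ (3 * s - 4) * (2 ^ (2 * s - 1) + 2 ^ s - 1) * (2 ^ (s - 1) + 1)),
      (2 ^ (2 * s - 1) - 2 ^ (s + 1),
        1 / 15 * 2 ^ (s - 3) * (2 ^ (4 * s - 2) - 5 * 2 ^ (2 * s - 2) + 1)
          * (2 ^ (2 * s - 1) - 2 ^ (s + 1) - 1) * (2 ^ (s - 2) - 1) / (2 ^ (2 * s) - 1)),
      (2 ^ (2 * s - 1) + 2 ^ (s + 1),
        1 / 15 * 2 ^ (s - 3) * (2 ^ (4 * s - 2) - 5 * 2 ^ (2 * s - 2) + 1)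
          * (2 ^ (2 * s - 1) + 2 ^ (s + 1) - 1) * (2 ^ (s - 2) + 1) / (2 ^ (2 * s) - 1))]
        : List (ℕ × ℚ)),
      weightCount (bchTraceCode F) p.1 ≠ 0 ∧
      ∃ l : ℕ, (l : ℚ) = p.2 ∧
        IsTDesign (supportBlocks (bchTraceCode F) p.1) 2 (2 ^ (2 * s)) p.1 l) := by
  have hchar : CharP F 2 := charP_of_injective_algebraMap (algebraMap (ZMod 2) F).injective 2
  have h64 : 64 ≤ Fintype.card F := by
    rw [hF]
    calc 64 = 2 ^ 6 := by norm_num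
      _ ≤ 2 ^ (2 * s) := Nat.pow_le_pow_right (by norm_num) (by omega)
  refine ⟨fun α hα => ⟨isExtendedCyclic_bchTraceCode h64 hα, affineGroup_subset_PAut⟩, ?_, ?_⟩
  · intro i hi hA
    have h2 : 2 ≤ i := by
      obtain ⟨c, hc, hw⟩ := Set.nonempty_of_ncard_ne_zero hA
      obtain ⟨p, h, rfl⟩ := mem_bchTraceCode.1 hc
      rw [← hw] at hi ⊢
      exact two_le_hammingNorm hs hF (.inl hi)
    obtain ⟨l, hd, hl⟩ := exists_isTDesign affineGroup_subset_PAut h2 hA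
    rw [hF] at hd
    refine ⟨l, Nat.pos_of_ne_zero ?_, hd⟩
    rintro rfl
    rw [zero_mul] at hl
    exact mul_ne_zero hA (mul_ne_zero hi (by omega)) hl.symm
  -- With t = 2^(s-3), every power of two in the statement becomes a monomial in t without truncated
  -- subtraction, and q = 64t².
  · obtain ⟨r, rfl⟩ : ∃ r, s = r + 3 := ⟨s - 3, by omega⟩
    obtain ⟨t, ht⟩ : ∃ t, t = 2 ^ r := ⟨_, rfl⟩
    have ht1 : 1 ≤ t := ht ▸ Nat.one_le_two_pow
    have htq : (2 : ℚ) ^ r = t := by rw [ht]; push_cast; rfl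
    have htz : (2 : ℤ) ^ r = t := by rw [ht]; push_cast; rfl
    have ht1q : (1 : ℚ) ≤ t := by exact_mod_cast ht1
    have hle : t ≤ t ^ 2 := Nat.le_self_pow two_ne_zero t
    have hq : Fintype.card F = 64 * t ^ 2 := by rw [hF, ht]; ring
    have hqq : (Fintype.card F : ℚ) = 64 * t ^ 2 := by rw [hq]; push_cast; ring
    have hqz : (Fintype.card F : ℤ) = 64 * t ^ 2 := by rw [hq]; push_cast; ring
    have c0 := quinticSumSqCount_zero hF hqq
    have c1 := quinticSumSqCount_two_pow hF hqq
    have c2 := quinticSumSqCount_two_mul hF hqq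
    have c4 := quinticSumSqCount_four_mul hF hqq
    rw [pow_add, htz] at c1 c2 c4
    have hneg : ∀ v : ℤ, quinticSumSqCount F (-v) = quinticSumSqCount F v := by
      intro v; simp [quinticSumSqCount]
    have hexp : 2 * (r + 3) - 1 = 2 * r + 5 ∧ 6 * (r + 3) - 5 = 6 * r + 13 ∧
        4 * (r + 3) - 5 = 4 * r + 7 ∧ 2 * (r + 3) - 3 = 2 * r + 3 ∧ r + 3 - 1 = r + 2 ∧
        3 * (r + 3) - 4 = 3 * r + 5 ∧ r + 3 + 1 = r + 4 ∧ r + 3 - 2 = r + 1 ∧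
        r + 3 - 3 = r ∧ 4 * (r + 3) - 2 = 4 * r + 10 ∧ 2 * (r + 3) - 2 = 2 * r + 4 ∧
        2 * (r + 3) = 2 * r + 6 ∧ 4 * (r + 3) = 4 * r + 12 := by omega
    obtain ⟨e1, e2, e3, e4, e5, e6, e7, e8, e9, e10, e11, e12, e13⟩ := hexp
    simp only [e1, e2, e3, e4, e5, e6, e7, e8, e9, e10, e11]
    -- Kept for a second pass because these left-hand sides occur inside the subtracted exponents.
    simp only [e12, e13]
    simp only [pow_add, pow_mul', htq, ← ht, List.forall_mem_cons]
    have hcard : Fintype.card F = t ^ 2 * 2 ^ 6 := by rw [hq]; ring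
    have p1 : (0 : ℚ) < 64 * t ^ 2 - 1 := by nlinarith
    have p4 : (0 : ℚ) < 64 * t ^ 2 - 4 := by nlinarith
    have n1 : (t : ℚ) ^ 2 * 2 ^ 6 - 1 ≠ 0 := by nlinarith
    have n2 : (t : ℚ) * 2 ^ 3 - 1 ≠ 0 := by nlinarith
    have n3 : (t : ℚ) * 2 ^ 3 + 1 ≠ 0 := by positivity
    refine ⟨?_, ?_, ?_, ?_, ?_, ?_, ?_, by simp⟩
    · have hc : (weightCount (bchTraceCode F) (t ^ 2 * 2 ^ 5) : ℚ) =
          29 * (t ^ 6 * 2 ^ 13) - 33 * (t ^ 4 * 2 ^ 7) + 17 * (t ^ 2 * 2 ^ 3) - 2 := by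
        rw [weightCount_half hs hF (by rw [hqz]; push_cast; ring)]
        push_cast
        rw [c0]
        ring
      refine exists_isTDesign_bchTraceCode hcard hc ?_ (by nlinarith) ?_
      · have u1 : (1 : ℚ) ≤ t ^ 2 := one_le_pow₀ ht1q
        have u2 : (t : ℚ) ^ 2 ≤ t ^ 4 := pow_le_pow_right₀ ht1q (by norm_num)
        have u3 : (t : ℚ) ^ 4 ≤ t ^ 6 := pow_le_pow_right₀ ht1q (by norm_num)
        linarith
      · push_cast
        rw [div_mul_eq_mul_div, eq_div_iff (mul_ne_zero two_ne_zero n1)]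
        ring
    -- The sum is 2kt and 2^s = 8t, so k = ±4, ±8, ±16 correspond to ±2^s, ±2^(s+1), ±2^(s+2).
    · refine exists_isTDesign_offset hs hF ht1 hcard 4 (by norm_num) (by norm_num) ?_ (Eq.trans (by congr 2; ring) c1)
        (by positivity) ?_
      · rw [Nat.cast_sub (show t * 2 ^ 2 ≤ t ^ 2 * 2 ^ 5 by omega)]; push_cast; ring
      · symm; rw [div_mul_eq_mul_div, div_eq_iff n3]; push_cast; ring
    · refine exists_isTDesign_offset hs hF ht1 hcard (-4) (by norm_num) (by norm_num) ?_
        (Eq.trans (by rw [← hneg]; congr 2; ring) c1) (by positivity) ?_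
      · push_cast; ring
      · symm; rw [div_mul_eq_mul_div, div_eq_iff n2]; push_cast; ring
    · refine exists_isTDesign_offset hs hF ht1 hcard 8 (by norm_num) (by norm_num) ?_ (Eq.trans (by congr 2; ring) c2)
        (by positivity) ?_
      · rw [Nat.cast_sub (show t * 2 ^ 3 ≤ t ^ 2 * 2 ^ 5 by omega)]; push_cast; ring
      · push_cast; ring
    · refine exists_isTDesign_offset hs hF ht1 hcard (-8) (by norm_num) (by norm_num) ?_
        (Eq.trans (by rw [← hneg]; congr 2; ring) c2) (by positivity) ?_
      · push_cast; ring
      · push_cast; ring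
    · refine exists_isTDesign_offset hs hF ht1 hcard 16 (by norm_num) (by norm_num) ?_ (Eq.trans (by congr 2; ring) c4)
        (by positivity) ?_
      · rw [Nat.cast_sub (show t * 2 ^ 4 ≤ t ^ 2 * 2 ^ 5 by omega)]; push_cast; ring
      · symm; rw [div_mul_eq_mul_div, div_eq_iff n1]; push_cast; ring
    · refine exists_isTDesign_offset hs hF ht1 hcard (-16) (by norm_num) (by norm_num) ?_
        (Eq.trans (by rw [← hneg]; congr 2; ring) c4) (by positivity) ?_
      · push_cast; ring
      · symm; rw [div_mul_eq_mul_div, div_eq_iff n1]; push_cast; ring
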